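/- Let $\lambda,a,b>0$, $q\ge 0$ and let $N\ge 1$ be an integer. Let $(N(t))_{t\ge 0}$ be a Poisson process of rate $\lambda$ with arrival epochs $T_1<T_2<\cdots$ (the interarrival times $T_1,T_2-T_1,\dots$ are i.i.d. exponential with parameter $\lambda$), and let, for initial capital $U(0)=x$, $$U(t)=x-t+\sum_{i=1}^{N(t)} a\,U(T_i-),\qquad t\ge 0 .$$ Write $\mathbb E_x$ for the expectation when $U(0)=x$. Put $L_n=\frac{b}{(a+1)^n}$, let $d_N=\inf\{t\ge 0: U(t)=L_N\}$ be the first time that $U$ reaches level $L_N$ and $u_0=\inf\{t\ge 0: U(t)>b\}$ the first time that $U$ up-crosses $L_0=b$ (with $\inf\emptyset=\infty$), and define $$\rho_N(x)=\mathbb E_x\left[e^{-qd_N}1_{\{d_N<u_0\}}\right],\qquad \rho_n=\rho_N(L_n)\quad (1\le n\le N).$$ For $c>0$ let $\bar G_c(t)=e^{-(\lambda+q)ct}$ and $g_c(t)=\lambda c\,e^{-(\lambda+q)ct}$ for $t\ge 0$, let $(f\circledast h)(y)=\int_0^y f(t)h(y-t)\,dt$, and set $$\gamma_0=\bar G_1,\qquad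 \gamma_j=\bar G_{(a+1)^j}\circledast g_{(a+1)^{j-1}}\circledast\cdots\circledast g_{a+1}\circledast g_1\quad (j\ge 1).$$ (1) For every $1\le n\le N$ and every $x$ with $L_n<x\le L_{n-1}$, the random variable $e^{-qd_N}1_{\{d_N<u_0\}}$ (for $U(0)=x$) is integrable and $$\rho_N(x)=\sum_{j=0}^{n-1}\gamma_j(x-L_n)\,\rho_{n-j}.$$ (2) $\rho_N(L_N)=1$, and the column vector $\rho=(\rho_1,\dots,\rho_{N-1})^T$ solves the linear system $$\rho=\Gamma\rho+Z .$$ Here, with $\gamma_{j,n}=\gamma_j\!\left(\frac{b}{(a+1)^n}\left(1-\frac1{a+1}\right)\right)$, $\Gamma$ is the $(N-1)\times(N-1)$ matrix whose entry in row $n$ and column $k$ is $\gamma_{n+1-k,n}$ if $k\le n+1$ and $0$ if $k>n+1$ (so row $n$ is $(\gamma_{n,n},\gamma_{n-1,n},\dots,\gamma_{0,n},0,\dots,0)$, cut off after $N-1$ entries), and $Z=(0,\dots,0,\gamma_{0,N-1})^T$. (For $N=1$ the system is empty.) -/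

import Mathlib

open MeasureTheory ProbabilityTheory
open scoped NNReal

noncomputable section

namespace DualRisk

/-! ### The surplus process

A path is determined by the initial capital `x`, the proportionality factor `a` and the
interarrival times `τ 0, τ 1, …`; the arrivals take place at `τ 0`, `τ 0 + τ 1`, …. -/

/-- The epoch of the arrival with index `i` (arrivals are indexed from `0`). -/
def arrivalTime (τ : ℕ → ℝ) (i : ℕ) : ℝ := ∑ k ∈ Finset.range (i + 1), τ k

/-- The number `N(t)` of arrivals in `[0, t]`. -/
def arrivalCount (τ : ℕ → ℝ) (t : ℝ≥0) : ℕ := {i : ℕ | arrivalTime τ i ≤ t}.ncard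

/-- The surplus just before the arrival with index `i`. At this arrival the surplus jumps up by
`a` times this amount; between arrivals it decreases at rate `1`. -/
def preJump (x a : ℝ) (τ : ℕ → ℝ) : ℕ → ℝ
  | 0 => x - τ 0
  | i + 1 => (1 + a) * preJump x a τ i - τ (i + 1)

/-- The surplus process with only proportional gains,
`U(t) = x - t + ∑_{arrivals i up to time t} a * U(T_i -)`. -/
def surplus {Ω : Type*} (x a : ℝ) (τ : ℕ → Ω → ℝ) (t : ℝ≥0) (ω : Ω) : ℝ :=
  x - t + ∑ i ∈ Finset.range (arrivalCount (fun k => τ k ω) t), a * preJump x a (fun k => τ k ω) i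

/-- The levels `L_n = b / (a + 1) ^ n`. -/
def level (a b : ℝ) (n : ℕ) : ℝ := b / (a + 1) ^ n

/-- `d_n`, the first time that the surplus reaches the level `L_n` (`⊤` if this never happens). -/
def downTime {Ω : Type*} (x a b : ℝ) (τ : ℕ → Ω → ℝ) (n : ℕ) : Ω → WithTop ℝ≥0 :=
  hittingAfter (surplus x a τ) {level a b n} 0

/-- `u_n`, the first time that the surplus is above the level `L_n` (`⊤` if this never happens). -/
def upTime {Ω : Type*} (x a b : ℝ) (τ : ℕ → Ω → ℝ) (n : ℕ) : Ω → WithTop ℝ≥0 :=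
  hittingAfter (surplus x a τ) (Set.Ioi (level a b n)) 0

open Classical in
/-- The discounted indicator `e ^ (-q d_N) 1_{d_N < u_0}` (`d_N` is finite on `{d_N < u_0}`). -/
def discountedExit {Ω : Type*} (a b q : ℝ) (τ : ℕ → Ω → ℝ) (N : ℕ) (x : ℝ) (ω : Ω) : ℝ :=
  if downTime x a b τ N ω < upTime x a b τ 0 ω then
    Real.exp (-q * ((downTime x a b τ N ω).untopD 0 : ℝ≥0)) else 0

/-- The two-sided exit transform `ρ_N(x) = E_x[e ^ (-q d_N) 1_{d_N < u_0}]`. -/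
def exitTransform {Ω : Type*} [MeasurableSpace Ω] (P : Measure Ω) (a b q : ℝ) (τ : ℕ → Ω → ℝ)
    (N : ℕ) (x : ℝ) : ℝ :=
  ∫ ω, discountedExit a b q τ N x ω ∂P

/-- `ρ_n = ρ_N(L_n)`. -/
def exitValue {Ω : Type*} [MeasurableSpace Ω] (P : Measure Ω) (a b q : ℝ) (τ : ℕ → Ω → ℝ)
    (N n : ℕ) : ℝ :=
  exitTransform P a b q τ N (level a b n)

/-! ### The convolutions -/

/-- `Ḡ_c(t) = e ^ (-(lam + q) c t)`. -/
def Gbar (lam q c : ℝ) (t : ℝ) : ℝ := Real.exp (-(lam + q) * c * t)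

/-- `g_c(t) = lam c e ^ (-(lam + q) c t)`. -/
def g (lam q c : ℝ) (t : ℝ) : ℝ := lam * c * Real.exp (-(lam + q) * c * t)

/-- Convolution of functions on the positive half-line, `(f ⊛ h)(x) = ∫_0^x f(t) h(x - t) dt`. -/
def conv (f h : ℝ → ℝ) : ℝ → ℝ := posConvolution f h (ContinuousLinearMap.mul ℝ ℝ)

/-- With `c = a + 1`, `gammaFrom lam q a i m` is the convolution
`Ḡ_{c ^ (i + m)} ⊛ g_{c ^ (i + m - 1)} ⊛ ⋯ ⊛ g_{c ^ i}`, bracketed from the left. -/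
def gammaFrom (lam q a : ℝ) : ℕ → ℕ → ℝ → ℝ
  | i, 0 => Gbar lam q ((a + 1) ^ i)
  | i, m + 1 => conv (gammaFrom lam q a (i + 1) m) (g lam q ((a + 1) ^ i))

/-- `γ_j = Ḡ_{(a + 1) ^ j} ⊛ g_{(a + 1) ^ (j - 1)} ⊛ ⋯ ⊛ g_1`, with `γ_0 = Ḡ_1`. -/
def gamma (lam q a : ℝ) (j : ℕ) : ℝ → ℝ := gammaFrom lam q a 0 j

/-- `γ_{j,n} = γ_j(L_n (1 - 1 / (a + 1)))`; note that `L_n (1 - 1 / (a + 1)) = L_n - L_{n+1}`. -/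
def gammaCoeff (lam q a b : ℝ) (j n : ℕ) : ℝ :=
  gamma lam q a j (b / (a + 1) ^ n * (1 - 1 / (a + 1)))

/-! ### The linear system

Vectors and matrices of size `N - 1` are indexed by `Fin (N - 1)`; the index `i` stands for the
row (or column) `i + 1 ∈ {1, …, N - 1}`. -/

/-- The matrix `Γ`, with row `n` equal to `(γ_{n,n}, γ_{n-1,n}, …, γ_{0,n}, 0, …, 0)`, that is,
with entry `γ_{n+1-k,n}` in row `n` and column `k ≤ n + 1`, and `0` in the columns `k > n + 1`. -/
def GammaMatrix (lam q a b : ℝ) (N : ℕ) : Matrix (Fin (N - 1)) (Fin (N - 1)) ℝ :=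
  Matrix.of fun i j =>
    let n : ℕ := i + 1
    let k : ℕ := j + 1
    if k ≤ n + 1 then gammaCoeff lam q a b (n + 1 - k) n else 0

/-- The vector `Z = (0, …, 0, γ_{0,N-1})`. -/
def ZVector (lam q a b : ℝ) (N : ℕ) : Fin (N - 1) → ℝ :=
  fun i => if (i : ℕ) + 1 = N - 1 then gammaCoeff lam q a b 0 (N - 1) else 0

/-- The vector `ρ = (ρ_1, …, ρ_{N-1})`. -/
def rhoVector {Ω : Type*} [MeasurableSpace Ω] (P : Measure Ω) (a b q : ℝ) (τ : ℕ → Ω → ℝ)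
    (N : ℕ) : Fin (N - 1) → ℝ :=
  fun i => exitValue P a b q τ N (i + 1)

end DualRisk

end

open Filter Set

namespace DualRisk

/-! ### Hitting times along a translated path -/

/-! The proof conditions on the first arrival. Put `L = level a b N` and let `F x` be the exit
transform from `x`. Starting in `[L, b]`, the surplus either reaches `L` before the first arrival,
or an arrival at time `t ≤ x - L` restarts it from `(1 + a) * (x - t)` with a fresh i.i.d. sequence
of interarrival times. Hence (`pathMean_eq`) `F x = e^(-(lam+q)(x-L)) + ∫_0^(x-L) lam e^(-(lam+q)t)
F((1+a)(x-t)) dt`, with `F = 0` above `b`.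

By the multiplicativity of the exponential, `L` may be replaced by any intermediate level `y`, at
the price of a factor `F y` (`renewal_split`). For `y = L_n` and `x` in `[L_n, L_(n-1)]` with `n ≥
2`, the restarted surplus lies in `[L_(n-1), L_(n-2)]`, because the levels are geometric with ratio
`1 + a`. Induction on `n` then gives the formula (`renewal_solution`): the integral operator sends
`γ_j` to `γ_(j+1)` (`gamma_succ`), by the scaling identity `gammaFrom_succ`. The linear system is
this formula at `x = L_n`, the top of the interval `[L_(n+1), L_n]`.

Measurability is not evident for a functional of hitting times. It comes from `exitApprox`, a
recursively defined measurable approximation which on almost every path is eventually equal to the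
exit functional. -/

theorem hittingAfter_eq_add {Ω Ω' β : Type*} {u : ℝ≥0 → Ω → β} {u' : ℝ≥0 → Ω' → β} {S : Set β}
    {ω : Ω} {ω' : Ω'} {r : ℝ≥0} (h0 : ∀ t < r, u t ω ∉ S) (h : ∀ t, u (r + t) ω = u' t ω') :
    hittingAfter u S 0 ω = r + hittingAfter u' S 0 ω' := by
  have key : ∀ t, u t ω ∈ S → ∃ t', t = r + t' ∧ u' t' ω' ∈ S := by
    intro t ht
    have hrt : r ≤ t := not_lt.1 fun hlt => h0 t hlt ht
    obtain ⟨t', rfl⟩ := exists_add_of_le hrt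
    exact ⟨t', rfl, h t' ▸ ht⟩
  by_cases hex : ∃ j, u' j ω' ∈ S
  · have hex' : ∃ j, u j ω ∈ S := by
      obtain ⟨j, hj⟩ := hex
      exact ⟨r + j, by rwa [h]⟩
    rw [hittingAfter, hittingAfter, if_pos (by simpa using hex'), if_pos (by simpa using hex),
      ← WithTop.coe_add, WithTop.coe_inj]
    simp only [zero_le, true_and]
    apply le_antisymm
    · rw [← tsub_le_iff_left]
      refine le_csInf hex fun t ht => ?_
      rw [tsub_le_iff_left]
      exact csInf_le (OrderBot.bddBelow _) (by simpa [h] using ht)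
    · refine le_csInf hex' fun t ht => ?_
      obtain ⟨t', rfl, ht'⟩ := key t ht
      gcongr
      exact csInf_le (OrderBot.bddBelow _) ht'
  · have hex' : ¬ ∃ j, u j ω ∈ S := by
      rintro ⟨j, hj⟩
      obtain ⟨t', -, ht'⟩ := key j hj
      exact hex ⟨t', ht'⟩
    rw [hittingAfter, hittingAfter, if_neg (by simpa using hex'), if_neg (by simpa using hex),
      WithTop.add_top]

theorem hittingAfter_eq_of_first {Ω β : Type*} {u : ℝ≥0 → Ω → β} {S : Set β} {ω : Ω} {r : ℝ≥0}
    (h0 : ∀ t < r, u t ω ∉ S) (h : u r ω ∈ S) : hittingAfter u S 0 ω = r := by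
  refine le_antisymm (hittingAfter_le_of_mem zero_le h) ?_
  by_contra! hlt
  obtain ⟨j, hj, hjS⟩ := hittingAfter_lt_iff.1 hlt
  exact h0 j hj.2 hjS

theorem lt_hittingAfter {Ω β : Type*} {u : ℝ≥0 → Ω → β} {S : Set β} {ω : Ω} {r r' : ℝ≥0}
    (hr : r < r') (h0 : ∀ t < r', u t ω ∉ S) : (r : WithTop ℝ≥0) < hittingAfter u S 0 ω := by
  by_contra! hle
  obtain ⟨j, hj, hjS⟩ := hittingAfter_lt_iff.1 (hle.trans_lt (WithTop.coe_lt_coe.2 hr))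
  exact h0 j hj.2 hjS

/-! ### Paths -/

/-- The sequence of interarrival times after the first one. -/
def tail (s : ℕ → ℝ) : ℕ → ℝ := fun n => s (n + 1)

/-- Positive interarrival times which exceed `b` infinitely often. -/
def IsRegular (b : ℝ) (s : ℕ → ℝ) : Prop := (∀ i, 0 < s i) ∧ ∀ m, ∃ k, m ≤ k ∧ b < s k

/-- The surplus as a functional of the sequence of interarrival times. -/
noncomputable abbrev pathSurplus (x a : ℝ) : ℝ≥0 → (ℕ → ℝ) → ℝ := surplus x a fun k s => s k

/-- The discounted exit indicator as a functional of the sequence of interarrival times. -/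
noncomputable abbrev pathExit (a b q : ℝ) (N : ℕ) (x : ℝ) : (ℕ → ℝ) → ℝ := discountedExit a b q (fun k s => s k) N x

theorem IsRegular.tail {b : ℝ} {s : ℕ → ℝ} (h : IsRegular b s) : IsRegular b (tail s) := by
  refine ⟨fun i => h.1 _, fun m => ?_⟩
  obtain ⟨k, hk, hbk⟩ := h.2 (m + 1)
  obtain ⟨j, rfl⟩ : ∃ j, k = j + 1 := ⟨k - 1, by omega⟩
  exact ⟨j, by omega, hbk⟩

theorem arrivalTime_succ (s : ℕ → ℝ) (i : ℕ) :
    arrivalTime s (i + 1) = s 0 + arrivalTime (tail s) i := by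
  rw [arrivalTime, Finset.sum_range_succ', add_comm]
  rfl

theorem arrivalTime_zero (s : ℕ → ℝ) : arrivalTime s 0 = s 0 := by simp [arrivalTime]

theorem preJump_succ (x a : ℝ) (s : ℕ → ℝ) (i : ℕ) :
    preJump x a s (i + 1) = preJump ((1 + a) * (x - s 0)) a (tail s) i := by
  induction i with
  | zero => rfl
  | succ i ih => rw [preJump, ih, preJump]; rfl

theorem le_arrivalTime {s : ℕ → ℝ} (hs : ∀ i, 0 < s i) (i : ℕ) : s 0 ≤ arrivalTime s i :=
  Finset.single_le_sum (fun k _ => (hs k).le) (by simp)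

/-- Infinitely many gaps exceed `b > 0`, so the arrival epochs diverge. Finiteness matters because
`ncard` of an infinite set is `0`, which would make `arrivalCount` meaningless. -/
theorem finite_arrivals {b : ℝ} (hb : 0 < b) {s : ℕ → ℝ} (h : IsRegular b s) (t : ℝ) :
    {i | arrivalTime s i ≤ t}.Finite := by
  have hns : ¬ Summable s := by
    intro hsum
    obtain ⟨m, hm⟩ := eventually_atTop.1 (hsum.tendsto_atTop_zero.eventually_lt_const hb)
    obtain ⟨k, hk, hbk⟩ := h.2 m
    exact absurd (hm k hk) (not_lt.2 hbk.le)
  have ht := (not_summable_iff_tendsto_nat_atTop_of_nonneg fun i => (h.1 i).le).1 hns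
  obtain ⟨m, hm⟩ := eventually_atTop.1 (ht.eventually_gt_atTop t)
  refine (finite_lt_nat m).subset fun i hi => ?_
  by_contra hle
  exact absurd (mem_ofPred.1 hi) (not_le.2 (hm (i + 1) (by simp only [mem_ofPred, not_lt] at hle; omega)))

theorem arrivalCount_of_lt {s : ℕ → ℝ} (hs : ∀ i, 0 < s i) {t : ℝ≥0} (ht : (t : ℝ) < s 0) :
    arrivalCount s t = 0 := by
  have : {i : ℕ | arrivalTime s i ≤ t} = ∅ := by
    ext i
    simpa using ht.trans_le (le_arrivalTime hs i)
  rw [arrivalCount, this, ncard_empty]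

theorem arrivalCount_add {b : ℝ} (hb : 0 < b) {s : ℕ → ℝ} (h : IsRegular b s) {r : ℝ≥0}
    (hr : (r : ℝ) = s 0) (t : ℝ≥0) : arrivalCount s (r + t) = arrivalCount (tail s) t + 1 := by
  have : {i : ℕ | arrivalTime s i ≤ (r + t : ℝ≥0)} =
      insert 0 (Nat.succ '' {i | arrivalTime (tail s) i ≤ t}) := by
    ext i
    cases i with
    | zero => simp [arrivalTime_zero, hr]
    | succ i => simp [arrivalTime_succ, hr]
  rw [arrivalCount, this, ncard_insert_of_notMem (by simp) ((finite_arrivals hb h.tail _).image _),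
    ncard_image_of_injective _ Nat.succ_injective, arrivalCount]

theorem pathSurplus_of_lt {s : ℕ → ℝ} (hs : ∀ i, 0 < s i) (x a : ℝ) {t : ℝ≥0}
    (ht : (t : ℝ) < s 0) : pathSurplus x a t s = x - t := by
  simp [pathSurplus, surplus, arrivalCount_of_lt hs ht]

theorem pathSurplus_add {b : ℝ} (hb : 0 < b) {s : ℕ → ℝ} (h : IsRegular b s) (x a : ℝ) {r : ℝ≥0}
    (hr : (r : ℝ) = s 0) (t : ℝ≥0) :
    pathSurplus x a (r + t) s = pathSurplus ((1 + a) * (x - s 0)) a t (tail s) := by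
  have h1 := arrivalCount_add hb h hr t
  simp only [pathSurplus, surplus]
  change x - _ + ∑ i ∈ Finset.range (arrivalCount s (r + t)), a * preJump x a s i =
    (1 + a) * (x - s 0) - t +
      ∑ i ∈ Finset.range (arrivalCount (tail s) t), a * preJump ((1 + a) * (x - s 0)) a (tail s) i
  rw [h1, Finset.sum_range_succ']
  simp only [preJump_succ]
  simp only [preJump, NNReal.coe_add, hr]
  ring

theorem pathExit_nonneg (a b q : ℝ) (N : ℕ) (x : ℝ) (s : ℕ → ℝ) : 0 ≤ pathExit a b q N x s := by
  unfold pathExit discountedExit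
  split_ifs <;> positivity

theorem pathExit_le_one (a b : ℝ) {q : ℝ} (hq : 0 ≤ q) (N : ℕ) (x : ℝ) (s : ℕ → ℝ) :
    pathExit a b q N x s ≤ 1 := by
  unfold pathExit discountedExit
  split_ifs
  · rw [Real.exp_le_one_iff, neg_mul, Left.neg_nonpos_iff]
    positivity
  · exact zero_le_one

theorem pathExit_of_gt {a b q : ℝ} {N : ℕ} {x : ℝ} (hx : b < x) {s : ℕ → ℝ} (hs : ∀ i, 0 < s i) :
    pathExit a b q N x s = 0 := by
  have : upTime x a b (fun k (s : ℕ → ℝ) => s k) 0 s = ((0 : ℝ≥0) : WithTop ℝ≥0) := by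
    refine hittingAfter_eq_of_first (by simp) ?_
    have := pathSurplus_of_lt hs x a (t := 0) (by simpa using hs 0)
    rw [pathSurplus] at this
    rw [this]
    simpa [level] using hx
  rw [pathExit, discountedExit, this, if_neg]
  exact not_lt.2 zero_le

theorem pathExit_of_no_arrival {a b q : ℝ} {N : ℕ} {x : ℝ} (hxL : level a b N ≤ x) (hxb : x ≤ b)
    {s : ℕ → ℝ} (hs : ∀ i, 0 < s i) (h0 : x - s 0 < level a b N) :
    pathExit a b q N x s = Real.exp (-q * (x - level a b N)) := by
  have hU : ∀ t : ℝ≥0, (t : ℝ) < s 0 → surplus x a (fun k (s : ℕ → ℝ) => s k) t s = x - t :=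
    fun t ht => pathSurplus_of_lt hs x a ht
  have hr : ((x - level a b N).toNNReal : ℝ) = x - level a b N :=
    Real.coe_toNNReal _ (by linarith)
  set r := (x - level a b N).toNNReal
  have hd : downTime x a b (fun k (s : ℕ → ℝ) => s k) N s = r := by
    refine hittingAfter_eq_of_first (fun t ht => ?_) ?_
    · have ht' : (t : ℝ) < r := NNReal.coe_lt_coe.2 ht
      rw [hU t (by linarith), mem_singleton_iff]
      intro h
      linarith
    · rw [hU r (by linarith), mem_singleton_iff]
      linarith
  have hu : (r : WithTop ℝ≥0) < upTime x a b (fun k (s : ℕ → ℝ) => s k) 0 s := by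
    have hs0 : ((s 0).toNNReal : ℝ) = s 0 := Real.coe_toNNReal _ (hs 0).le
    refine lt_hittingAfter (r' := (s 0).toNNReal) ?_ fun t ht => ?_
    · rw [← NNReal.coe_lt_coe]
      linarith
    · rw [← NNReal.coe_lt_coe, hs0] at ht
      rw [hU t ht]
      simp only [level, pow_zero, div_one, mem_Ioi, not_lt]
      linarith [t.coe_nonneg]
  rw [pathExit, discountedExit, hd, if_pos hu, WithTop.untopD_coe, hr]

/-- The boundary case `x - s 0 = L_N` belongs here: the jump takes place at the very instant at
which `L_N` would be reached, so the level is not hit before the restart. Both hitting times are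
shifted by the finite amount `s 0`, which preserves their strict order. -/
theorem pathExit_of_arrival {a b q : ℝ} (hb : 0 < b) {N : ℕ} {x : ℝ} (hxb : x ≤ b)
    {s : ℕ → ℝ} (h : IsRegular b s) (h0 : level a b N ≤ x - s 0) :
    pathExit a b q N x s = Real.exp (-q * s 0) * pathExit a b q N ((1 + a) * (x - s 0)) (tail s) := by
  have hU : ∀ t : ℝ≥0, (t : ℝ) < s 0 → surplus x a (fun k (s : ℕ → ℝ) => s k) t s = x - t :=
    fun t ht => pathSurplus_of_lt h.1 x a ht
  have hr : ((s 0).toNNReal : ℝ) = s 0 := Real.coe_toNNReal _ (h.1 0).le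
  have hadd := fun t => pathSurplus_add hb h x a hr t
  set r := (s 0).toNNReal
  have hd : downTime x a b (fun k (s : ℕ → ℝ) => s k) N s =
      r + downTime ((1 + a) * (x - s 0)) a b (fun k (s : ℕ → ℝ) => s k) N (tail s) := by
    refine hittingAfter_eq_add (fun t ht => ?_) hadd
    rw [← NNReal.coe_lt_coe, hr] at ht
    rw [hU t ht, mem_singleton_iff]
    intro h
    linarith
  have hu : upTime x a b (fun k (s : ℕ → ℝ) => s k) 0 s =
      r + upTime ((1 + a) * (x - s 0)) a b (fun k (s : ℕ → ℝ) => s k) 0 (tail s) := by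
    refine hittingAfter_eq_add (fun t ht => ?_) hadd
    rw [← NNReal.coe_lt_coe, hr] at ht
    rw [hU t ht]
    simp only [level, pow_zero, div_one, mem_Ioi, not_lt]
    linarith [t.coe_nonneg]
  unfold pathExit discountedExit
  rw [hd, hu]
  have hlt : ∀ d u : WithTop ℝ≥0, (r : WithTop ℝ≥0) + d < r + u ↔ d < u := fun d u =>
    WithTop.add_lt_add_iff_left WithTop.coe_ne_top
  simp only [hlt]
  split_ifs with hc
  · obtain ⟨d, hd'⟩ := WithTop.ne_top_iff_exists.1 hc.ne_top
    rw [← hd', ← WithTop.coe_add, WithTop.untopD_coe, WithTop.untopD_coe, ← Real.exp_add,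
      NNReal.coe_add, hr]
    ring_nf
  · simp

/-! ### Approximation of the exit functional -/

open Classical in
/-- The contribution to the discounted exit functional with level `L` of the paths that exit before
the arrival with index `k`. -/
noncomputable def exitApprox (a b q L : ℝ) : ℕ → ℝ → (ℕ → ℝ) → ℝ
  | 0, _, _ => 0
  | k + 1, x, s =>
      if x ∈ Icc L b then
        if x - s 0 < L then Real.exp (-q * (x - L))
        else Real.exp (-q * s 0) * exitApprox a b q L k ((1 + a) * (x - s 0)) (tail s)
      else 0

theorem measurable_tail : Measurable tail := measurable_pi_lambda _ fun _ => measurable_pi_apply _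

theorem measurable_exitApprox (a b q L : ℝ) (k : ℕ) :
    Measurable fun p : ℝ × (ℕ → ℝ) => exitApprox a b q L k p.1 p.2 := by
  have hm := measurable_tail
  induction k with
  | zero => exact measurable_const
  | succ k ih =>
    have h0 : Measurable fun p : ℝ × (ℕ → ℝ) => p.2 0 := (measurable_pi_apply 0).comp measurable_snd
    have h1 : Measurable fun p : ℝ × (ℕ → ℝ) =>
        exitApprox a b q L k ((1 + a) * (p.1 - p.2 0)) (tail p.2) :=
      ih.comp (((measurable_fst.sub h0).const_mul (1 + a)).prodMk (hm.comp measurable_snd))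
    refine Measurable.ite (measurable_fst measurableSet_Icc) (Measurable.ite ?_ ?_ ?_)
      measurable_const
    · exact measurableSet_lt (measurable_fst.sub h0) measurable_const
    · fun_prop
    · exact (h0.const_mul (-q)).exp.mul h1

theorem exitApprox_nonneg (a b q L : ℝ) (k : ℕ) (x : ℝ) (s : ℕ → ℝ) :
    0 ≤ exitApprox a b q L k x s := by
  induction k generalizing x s with
  | zero => exact le_rfl
  | succ k ih =>
    rw [exitApprox]
    split_ifs
    · positivity
    · exact mul_nonneg (Real.exp_nonneg _) (ih _ _)
    · exact le_rfl

theorem exitApprox_le_one (a b : ℝ) {q : ℝ} (hq : 0 ≤ q) (L : ℝ) (k : ℕ) (x : ℝ) {s : ℕ → ℝ}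
    (hs : ∀ i, 0 < s i) : exitApprox a b q L k x s ≤ 1 := by
  induction k generalizing x s with
  | zero => exact zero_le_one
  | succ k ih =>
    rw [exitApprox]
    split_ifs with h1 h2
    · rw [Real.exp_le_one_iff]
      nlinarith [h1.1]
    · refine mul_le_one₀ ?_ (exitApprox_nonneg _ _ _ _ _ _ _) (ih _ fun i => hs _)
      rw [Real.exp_le_one_iff]
      nlinarith [hs 0]
    · exact zero_le_one

/-- A path that has not exited before the arrival with index `k` starts its next descent from at
most `b`. A gap longer than `b` then carries it below `0 < L_N` before that arrival, so the
recursion has terminated within `k + 1` steps. Restarts never fall below `L_N`, so the value `0`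
that `exitApprox` takes there is harmless. -/
theorem pathExit_eq_exitApprox {a b q : ℝ} (ha : 0 < a) (hb : 0 < b) {N : ℕ} {k m : ℕ} (hm : k < m)
    {x : ℝ} (hx : level a b N ≤ x) {s : ℕ → ℝ} (h : IsRegular b s) (hk : b < s k) :
    pathExit a b q N x s = exitApprox a b q (level a b N) m x s := by
  have hL : 0 < level a b N := by unfold level; positivity
  induction k generalizing m x s with
  | zero =>
    obtain ⟨m, rfl⟩ : ∃ j, m = j + 1 := ⟨m - 1, by omega⟩
    rw [exitApprox]
    split_ifs with h1 h2
    · exact pathExit_of_no_arrival h1.1 h1.2 h.1 h2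
    · exact absurd (show x - s 0 < level a b N by linarith [h1.2]) h2
    · exact pathExit_of_gt (not_le.1 fun hxb => h1 ⟨hx, hxb⟩) h.1
  | succ k ih =>
    obtain ⟨m, rfl⟩ : ∃ j, m = j + 1 := ⟨m - 1, by omega⟩
    rw [exitApprox]
    split_ifs with h1 h2
    · exact pathExit_of_no_arrival h1.1 h1.2 h.1 h2
    · rw [not_lt] at h2
      rw [pathExit_of_arrival hb h1.2 h h2, ih (m := m) (by omega) (by nlinarith) h.tail hk]
    · exact pathExit_of_gt (not_le.1 fun hxb => h1 ⟨hx, hxb⟩) h.1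

theorem tendsto_exitApprox {a b q : ℝ} (ha : 0 < a) (hb : 0 < b) {N : ℕ}
    {x : ℝ} (hx : level a b N ≤ x) {s : ℕ → ℝ} (h : IsRegular b s) :
    Tendsto (fun m => exitApprox a b q (level a b N) m x s) atTop
      (nhds (pathExit a b q N x s)) := by
  obtain ⟨k, -, hk⟩ := h.2 0
  exact tendsto_const_nhds.congr' ((eventually_gt_atTop k).mono fun m hm =>
    pathExit_eq_exitApprox ha hb hm hx h hk)

/-! ### Sequences of independent identically distributed random variables -/

/-- The sequence with a given first term and a given tail. -/
def consSeq (p : ℝ × (ℕ → ℝ)) : ℕ → ℝ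
  | 0 => p.1
  | n + 1 => p.2 n

theorem measurable_consSeq : Measurable consSeq := by
  refine measurable_pi_lambda _ fun n => ?_
  cases n with
  | zero => exact measurable_fst
  | succ n => exact (measurable_pi_apply n).comp measurable_snd

/-- This makes conditioning on the first interarrival time an instance of Fubini. It suffices to
compare the measures of finite-dimensional boxes. -/
theorem measurePreserving_consSeq (ν : Measure ℝ) [IsProbabilityMeasure ν] :
    MeasurePreserving consSeq (ν.prod (Measure.infinitePi fun _ : ℕ => ν))
      (Measure.infinitePi fun _ : ℕ => ν) := by
  refine ⟨measurable_consSeq, Measure.eq_infinitePi _ fun S t ht => ?_⟩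
  classical
  obtain ⟨n, hn⟩ : ∃ n, S ⊆ Finset.range (n + 1) := by
    obtain ⟨n, hn⟩ := S.exists_nat_subset_range
    exact ⟨n, hn.trans (Finset.range_subset_range.2 n.le_succ)⟩
  -- Padding with `univ` turns the box over `S` into one over an initial segment, whose product
  -- splits off the factor of index `0`.
  set t' : ℕ → Set ℝ := fun i => if i ∈ S then t i else univ with ht'
  have htm : ∀ i, MeasurableSet (t' i) := by
    intro i
    simp only [ht']
    split_ifs
    exacts [ht i, MeasurableSet.univ]
  have hpre : consSeq ⁻¹' (Set.pi S t) =
      t' 0 ×ˢ Set.pi (Finset.range n : Set ℕ) fun i => t' (i + 1) := by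
    ext ⟨r, s⟩
    simp only [mem_preimage, Set.mem_pi, mem_prod, ht']
    constructor
    · intro h
      refine ⟨?_, fun i _ => ?_⟩
      · split_ifs with h0
        exacts [h 0 h0, trivial]
      · split_ifs with h0
        exacts [h (i + 1) h0, trivial]
    · rintro ⟨h0, h1⟩ i hi
      cases i with
      | zero => rw [if_pos (by simpa using hi)] at h0; exact h0
      | succ i =>
        have := h1 i (by have := hn hi; simpa using this)
        rw [if_pos (by simpa using hi)] at this
        exact this
  rw [Measure.map_apply measurable_consSeq (MeasurableSet.pi S.countable_toSet fun i _ => ht i),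
    hpre, Measure.prod_prod, Measure.infinitePi_pi _ fun i _ => htm _, mul_comm,
    ← Finset.prod_range_succ' (fun i => ν (t' i)), ← Finset.prod_subset hn]
  · refine Finset.prod_congr rfl fun i hi => ?_
    simp [ht', hi]
  · intro i _ hi
    simp [ht', hi]

theorem ae_forall_of_ae {ν : Measure ℝ} [IsProbabilityMeasure ν] {p : ℝ → Prop}
    (h : ∀ᵐ t ∂ν, p t) : ∀ᵐ s ∂(Measure.infinitePi fun _ : ℕ => ν), ∀ i, p (s i) :=
  ae_all_iff.2 fun i =>
    (measurePreserving_eval_infinitePi (fun _ : ℕ => ν) i).quasiMeasurePreserving.ae h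

theorem ae_exists_lt {ν : Measure ℝ} [IsProbabilityMeasure ν] {b : ℝ} (h : ν (Iic b) < 1) :
    ∀ᵐ s ∂(Measure.infinitePi fun _ : ℕ => ν), ∀ m, ∃ k, m ≤ k ∧ b < s k := by
  rw [ae_all_iff]
  intro m
  rw [ae_iff]
  -- The event that all gaps from index `m` on are at most `b` has probability at most `ν (Iic b) ^
  -- n` for every `n`.
  refine le_antisymm (ge_of_tendsto' (ENNReal.tendsto_pow_atTop_nhds_zero_of_lt_one h) fun n => ?_)
    zero_le
  calc _ ≤ Measure.infinitePi (fun _ : ℕ => ν)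
        (Set.pi (Finset.Ico m (m + n) : Set ℕ) fun _ => Iic b) := by
        refine measure_mono fun s hs i hi => ?_
        simp only [not_exists, not_and, not_lt, mem_ofPred] at hs
        exact hs i (Finset.mem_Ico.1 hi).1
    _ = ν (Iic b) ^ n := by
        rw [Measure.infinitePi_pi _ fun _ _ => measurableSet_Iic]
        simp

/-! ### The exponential distribution -/

theorem integral_expMeasure {lam : ℝ} (hlam : 0 < lam) (h : ℝ → ℝ) :
    ∫ t, h t ∂(expMeasure lam) = ∫ t in Ioi 0, lam * Real.exp (-lam * t) * h t := by
  have hm : expMeasure lam = volume.withDensity (exponentialPDF lam) := rfl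
  have hmeas : Measurable (exponentialPDF lam) :=
    (measurable_exponentialPDFReal lam).ennreal_ofReal
  rw [hm, integral_withDensity_eq_integral_toReal_smul hmeas (by simp [exponentialPDF]),
    ← integral_Ici_eq_integral_Ioi, ← integral_indicator measurableSet_Ici]
  congr 1
  ext t
  by_cases ht : 0 ≤ t
  · rw [indicator_of_mem (mem_Ici.2 ht), exponentialPDF_of_nonneg ht,
      ENNReal.toReal_ofReal (by positivity), smul_eq_mul, neg_mul]
  · rw [indicator_of_notMem (by simpa using ht), exponentialPDF_of_neg (not_le.1 ht)]
    simp

theorem ae_pos_expMeasure {lam : ℝ} : ∀ᵐ t ∂(expMeasure lam), 0 < t := by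
  have hm : expMeasure lam = volume.withDensity (exponentialPDF lam) := rfl
  rw [ae_iff, hm]
  have : {t : ℝ | ¬ 0 < t} = Iic 0 := by ext; simp
  rw [this, withDensity_apply _ measurableSet_Iic, ← setLIntegral_congr Iio_ae_eq_Iic]
  exact lintegral_exponentialPDF_of_nonpos le_rfl

theorem expMeasure_Iic_lt_one {lam : ℝ} (hlam : 0 < lam) (b : ℝ) : expMeasure lam (Iic b) < 1 := by
  have hm : expMeasure lam = volume.withDensity (exponentialPDF lam) := rfl
  rw [hm, withDensity_apply _ measurableSet_Iic, lintegral_exponentialPDF_eq_antiDeriv hlam,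
    ENNReal.ofReal_lt_one]
  split_ifs
  · linarith [Real.exp_pos (-(lam * b))]
  · exact zero_lt_one

/-- Here `r` plays the role of `x - L`: no arrival up to time `r` has probability `e^(-lam r)`, and
the descent is discounted by `e^(-q r)`. -/
theorem integral_expMeasure_ite {lam q : ℝ} (hlam : 0 < lam) {r : ℝ} (hr : 0 ≤ r)
    {F : ℝ → ℝ} (hF : Measurable F) {C : ℝ} (hC : ∀ t, |F t| ≤ C) :
    ∫ t, (if r < t then Real.exp (-q * r) else Real.exp (-q * t) * F t) ∂(expMeasure lam) =
      Real.exp (-(lam + q) * r) + ∫ t in 0..r, lam * Real.exp (-(lam + q) * t) * F t := by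
  have e1 : EqOn (fun t => lam * Real.exp (-lam * t) *
      (if r < t then Real.exp (-q * r) else Real.exp (-q * t) * F t))
      (fun t => lam * Real.exp (-(lam + q) * t) * F t) (Ioc 0 r) := by
    intro t ht
    simp only [if_neg (not_lt.2 ht.2)]
    rw [show -(lam + q) * t = -lam * t + -q * t by ring, Real.exp_add]
    ring
  have e2 : EqOn (fun t => lam * Real.exp (-lam * t) *
      (if r < t then Real.exp (-q * r) else Real.exp (-q * t) * F t))
      (fun t => lam * Real.exp (-q * r) * Real.exp (-lam * t)) (Ioi r) := by
    intro t ht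
    simp only [if_pos (mem_Ioi.1 ht)]
    ring
  have hi1 : IntegrableOn (fun t => lam * Real.exp (-(lam + q) * t) * F t) (Ioc 0 r) := by
    refine Integrable.mul_bdd (c := C) ?_ hF.aestronglyMeasurable (ae_of_all _ hC)
    exact (Continuous.integrableOn_Icc (by fun_prop)).mono_set Ioc_subset_Icc_self
  have hi2 : IntegrableOn (fun t => lam * Real.exp (-q * r) * Real.exp (-lam * t)) (Ioi r) :=
    (exp_neg_integrableOn_Ioi r hlam).const_mul _
  rw [integral_expMeasure hlam, ← Ioc_union_Ioi_eq_Ioi hr,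
    setIntegral_union (Ioc_disjoint_Ioi le_rfl) measurableSet_Ioi
      (hi1.congr_fun e1.symm measurableSet_Ioc) (hi2.congr_fun e2.symm measurableSet_Ioi),
    setIntegral_congr_fun measurableSet_Ioc e1, setIntegral_congr_fun measurableSet_Ioi e2,
    integral_const_mul, integral_exp_mul_Ioi (by linarith), add_comm,
    intervalIntegral.integral_of_le hr,
    show -(lam + q) * r = -q * r + -lam * r by ring, Real.exp_add]
  congr 1
  field_simp

/-! ### The exit transform -/

/-- The law of a sequence of independent exponential interarrival times. -/
noncomputable abbrev arrivalLaw (lam : ℝ) : Measure (ℕ → ℝ) :=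
  Measure.infinitePi fun _ : ℕ => expMeasure lam

theorem ae_isRegular {lam : ℝ} (hlam : 0 < lam) (b : ℝ) :
    ∀ᵐ s ∂(arrivalLaw lam), IsRegular b s := by
  have := isProbabilityMeasure_expMeasure hlam
  filter_upwards [ae_forall_of_ae (ν := expMeasure lam) ae_pos_expMeasure,
    ae_exists_lt (expMeasure_Iic_lt_one hlam b)] with s h1 h2
  exact ⟨h1, h2⟩

theorem ae_norm_exitApprox_le {lam : ℝ} (hlam : 0 < lam) (a b : ℝ) {q : ℝ} (hq : 0 ≤ q) (L : ℝ)
    (k : ℕ) (x : ℝ) : ∀ᵐ s ∂(arrivalLaw lam), ‖exitApprox a b q L k x s‖ ≤ 1 := by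
  filter_upwards [ae_isRegular hlam b] with s hs
  rw [Real.norm_of_nonneg (exitApprox_nonneg _ _ _ _ _ _ _)]
  exact exitApprox_le_one a b hq L k x hs.1

theorem integrable_exitApprox {lam : ℝ} (hlam : 0 < lam) (a b : ℝ) {q : ℝ} (hq : 0 ≤ q) (L : ℝ)
    (k : ℕ) (x : ℝ) : Integrable (exitApprox a b q L k x) (arrivalLaw lam) := by
  have := isProbabilityMeasure_expMeasure hlam
  exact Integrable.of_bound
    ((measurable_exitApprox a b q L k).comp measurable_prodMk_left).aestronglyMeasurable 1
    (ae_norm_exitApprox_le hlam a b hq L k x)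

theorem integrable_pathExit {lam : ℝ} (hlam : 0 < lam) {a b q : ℝ} (ha : 0 < a) (hb : 0 < b)
    (hq : 0 ≤ q) {N : ℕ} {x : ℝ} (hx : level a b N ≤ x) :
    Integrable (pathExit a b q N x) (arrivalLaw lam) := by
  have := isProbabilityMeasure_expMeasure hlam
  refine Integrable.of_bound (aestronglyMeasurable_of_tendsto_ae atTop
    (fun m => (integrable_exitApprox hlam a b hq (level a b N) m x).aestronglyMeasurable) ?_) 1
    (ae_of_all _ fun s => ?_)
  · filter_upwards [ae_isRegular hlam b] with s hs
    exact tendsto_exitApprox ha hb hx hs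
  · rw [Real.norm_of_nonneg (pathExit_nonneg _ _ _ _ _ _)]
    exact pathExit_le_one a b hq N x s

/-- The expected value of the approximate exit functional. -/
noncomputable def approxMean (lam a b q L : ℝ) (k : ℕ) (x : ℝ) : ℝ :=
  ∫ s, exitApprox a b q L k x s ∂(arrivalLaw lam)

theorem measurable_approxMean {lam : ℝ} (hlam : 0 < lam) (a b q L : ℝ) (k : ℕ) :
    Measurable (approxMean lam a b q L k) := by
  have := isProbabilityMeasure_expMeasure hlam
  exact ((measurable_exitApprox a b q L k).stronglyMeasurable.integral_prod_right'
    (ν := arrivalLaw lam)).measurable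

theorem abs_approxMean_le {lam : ℝ} (hlam : 0 < lam) (a b : ℝ) {q : ℝ} (hq : 0 ≤ q) (L : ℝ)
    (k : ℕ) (x : ℝ) : |approxMean lam a b q L k x| ≤ 1 := by
  have := isProbabilityMeasure_expMeasure hlam
  simpa [approxMean] using norm_integral_le_of_norm_le_const (ae_norm_exitApprox_le hlam a b hq L k x)

theorem tendsto_approxMean {lam : ℝ} (hlam : 0 < lam) {a b q : ℝ} (ha : 0 < a) (hb : 0 < b)
    (hq : 0 ≤ q) {N : ℕ} {x : ℝ} (hx : level a b N ≤ x) :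
    Tendsto (fun k => approxMean lam a b q (level a b N) k x) atTop
      (nhds (∫ s, pathExit a b q N x s ∂(arrivalLaw lam))) := by
  have := isProbabilityMeasure_expMeasure hlam
  refine tendsto_integral_of_dominated_convergence (fun _ => 1)
    (fun k => (integrable_exitApprox hlam a b hq _ k x).aestronglyMeasurable)
    (integrable_const _) (fun k => ae_norm_exitApprox_le hlam a b hq _ k x) ?_
  filter_upwards [ae_isRegular hlam b] with s hs
  exact tendsto_exitApprox ha hb hx hs

theorem approxMean_succ {lam : ℝ} (hlam : 0 < lam) (a b : ℝ) {q : ℝ} (hq : 0 ≤ q) {L : ℝ} (k : ℕ)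
    {x : ℝ} (hx : x ∈ Icc L b) :
    approxMean lam a b q L (k + 1) x =
      Real.exp (-(lam + q) * (x - L)) + ∫ t in 0..(x - L),
        lam * Real.exp (-(lam + q) * t) * approxMean lam a b q L k ((1 + a) * (x - t)) := by
  have := isProbabilityMeasure_expMeasure hlam
  have hmp : MeasurePreserving consSeq ((expMeasure lam).prod (arrivalLaw lam)) (arrivalLaw lam) :=
    measurePreserving_consSeq (expMeasure lam)
  have hint := integrable_exitApprox hlam a b hq L (k + 1) x
  have hite := integral_expMeasure_ite (q := q) hlam (sub_nonneg.2 hx.1)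
    ((measurable_approxMean hlam a b q L k).comp (by fun_prop : Measurable fun t => (1 + a) * (x - t)))
    (fun t => abs_approxMean_le hlam a b hq L k _)
  simp only [Function.comp] at hite
  rw [← hite]
  rw [approxMean, ← hmp.map_eq, integral_map hmp.measurable.aemeasurable
    (by rw [hmp.map_eq]; exact hint.aestronglyMeasurable)]
  refine (integral_prod _ ((hmp.integrable_comp hint.aestronglyMeasurable).2 hint)).trans ?_
  congr 1
  ext t
  have htail : ∀ s, tail (consSeq (t, s)) = s := fun s => rfl
  have hhead : ∀ s, consSeq (t, s) 0 = t := fun s => rfl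
  simp only [Function.comp, exitApprox, if_pos hx, htail, hhead, sub_lt_comm (a := x) (b := t) (c := L)]
  split_ifs with h
  · simp
  · rw [integral_const_mul]
    rfl

theorem pathMean_eq {lam : ℝ} (hlam : 0 < lam) {a b q : ℝ} (ha : 0 < a) (hb : 0 < b)
    (hq : 0 ≤ q) {N : ℕ} {x : ℝ} (hx : x ∈ Icc (level a b N) b) :
    ∫ s, pathExit a b q N x s ∂(arrivalLaw lam) =
      Real.exp (-(lam + q) * (x - level a b N)) + ∫ t in 0..(x - level a b N),
        lam * Real.exp (-(lam + q) * t) *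
          ∫ s, pathExit a b q N ((1 + a) * (x - t)) s ∂(arrivalLaw lam) := by
  have hL : 0 < level a b N := by unfold level; positivity
  refine tendsto_nhds_unique ((tendsto_approxMean hlam ha hb hq hx.1).comp (tendsto_add_atTop_nat 1))
    ?_
  simp only [Function.comp_def, approxMean_succ hlam a b hq _ hx]
  refine tendsto_const_nhds.add (intervalIntegral.tendsto_integral_filter_of_dominated_convergence
    (fun t => lam * Real.exp (-(lam + q) * t)) (Eventually.of_forall fun k => ?_)
    (Eventually.of_forall fun k => ae_of_all _ fun t _ => ?_)
    (Continuous.intervalIntegrable (by fun_prop) _ _) (ae_of_all _ fun t ht => ?_))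
  · have := measurable_approxMean hlam a b q (level a b N) k
    exact Measurable.aestronglyMeasurable (by fun_prop)
  · rw [norm_mul, Real.norm_of_nonneg (by positivity)]
    exact mul_le_of_le_one_right (by positivity) (abs_approxMean_le hlam a b hq _ k _)
  · rw [uIoc_of_le (sub_nonneg.2 hx.1)] at ht
    exact (tendsto_approxMean hlam ha hb hq (by nlinarith [ht.2])).const_mul _

/-- The approximations are known to converge only for starting points at or above `L_N`. Clamping
the starting point there gives a function that is measurable and bounded on the whole line. -/
theorem exists_measurable_pathMean {lam : ℝ} (hlam : 0 < lam) {a b q : ℝ} (ha : 0 < a) (hb : 0 < b)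
    (hq : 0 ≤ q) (N : ℕ) : ∃ F : ℝ → ℝ, Measurable F ∧ (∀ x, |F x| ≤ 1) ∧ ∀ x, level a b N ≤ x →
      ∫ s, pathExit a b q N x s ∂(arrivalLaw lam) = F x := by
  have := isProbabilityMeasure_expMeasure hlam
  refine ⟨fun x => ∫ s, pathExit a b q N (max (level a b N) x) s ∂(arrivalLaw lam), ?_, fun x => ?_,
    fun x hx => by simp only [max_eq_right hx]⟩
  · refine measurable_of_tendsto_metrizable (f := fun k x =>
      approxMean lam a b q (level a b N) k (max (level a b N) x)) (fun k => ?_)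
      (tendsto_pi_nhds.2 fun x => tendsto_approxMean hlam ha hb hq (le_max_left _ _))
    have := measurable_approxMean hlam a b q (level a b N) k
    exact this.comp (by fun_prop)
  · exact le_of_tendsto' (tendsto_approxMean hlam ha hb hq (le_max_left _ _)).abs
      fun k => abs_approxMean_le hlam a b hq _ k _

theorem pathMean_of_gt {lam : ℝ} (hlam : 0 < lam) {a b q : ℝ} {N : ℕ} {x : ℝ} (hx : b < x) :
    ∫ s, pathExit a b q N x s ∂(arrivalLaw lam) = 0 := by
  refine integral_eq_zero_of_ae ?_
  filter_upwards [ae_isRegular hlam b] with s hs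
  exact pathExit_of_gt hx hs.1

/-! ### The convolutions -/

theorem conv_of_nonneg (f h : ℝ → ℝ) {x : ℝ} (hx : 0 ≤ x) :
    conv f h x = ∫ t in 0..x, f t * h (x - t) := by
  rcases hx.eq_or_lt with rfl | hx
  · simp [conv, posConvolution]
  · simp [conv, posConvolution, indicator_of_mem (mem_Ioi.2 hx)]

/-- Continuity can only be asked on `[0, ∞)`, since `posConvolution` vanishes off the positive
half-line. It serves to make the integrals of `gamma` exist. -/
theorem exists_continuous_gammaFrom (lam q a : ℝ) (i m : ℕ) :
    ∃ G : ℝ → ℝ, Continuous G ∧ EqOn (gammaFrom lam q a i m) G (Ici 0) := by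
  induction m generalizing i with
  | zero => exact ⟨Gbar lam q ((a + 1) ^ i), by unfold Gbar; fun_prop, fun _ _ => rfl⟩
  | succ m ih =>
    obtain ⟨G, hG, hEq⟩ := ih (i + 1)
    refine ⟨fun x => ∫ t in 0..x, G t * g lam q ((a + 1) ^ i) (x - t), ?_, fun x hx => ?_⟩
    · exact intervalIntegral.continuous_parametric_intervalIntegral_of_continuous
        (f := fun x t => G t * g lam q ((a + 1) ^ i) (x - t)) (by unfold g; fun_prop) continuous_id
    · rw [gammaFrom, conv_of_nonneg _ _ hx]
      refine intervalIntegral.integral_congr fun t ht => ?_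
      rw [uIcc_of_le hx] at ht
      simp only [hEq (mem_Ici.2 ht.1)]

/-- Since `g_(c * d)(t) = c * g_d(c * t)`, the extra factor `c = a + 1` is exactly the Jacobian of
the substitution `t ↦ c * t` in each convolution. -/
theorem gammaFrom_succ {a : ℝ} (ha : 0 < a) (lam q : ℝ) (i m : ℕ) {s : ℝ} (hs : 0 ≤ s) :
    gammaFrom lam q a (i + 1) m s = gammaFrom lam q a i m ((a + 1) * s) := by
  induction m generalizing i s with
  | zero => simp only [gammaFrom, Gbar]; ring_nf
  | succ m ih =>
    have hc : a + 1 ≠ 0 := by positivity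
    rw [gammaFrom, gammaFrom, conv_of_nonneg _ _ hs, conv_of_nonneg _ _ (by positivity)]
    have := intervalIntegral.smul_integral_comp_mul_left (a := 0) (b := s)
      (fun t => gammaFrom lam q a (i + 1) m t * g lam q ((a + 1) ^ i) ((a + 1) * s - t)) (a + 1)
    rw [mul_zero] at this
    rw [← this, smul_eq_mul, ← intervalIntegral.integral_const_mul]
    refine intervalIntegral.integral_congr fun t ht => ?_
    rw [uIcc_of_le hs] at ht
    simp only [ih (i + 1) ht.1, g]
    ring_nf

theorem gamma_succ {a : ℝ} (ha : 0 < a) (lam q : ℝ) (j : ℕ) {r : ℝ} (hr : 0 ≤ r) :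
    gamma lam q a (j + 1) r =
      ∫ t in 0..r, lam * Real.exp (-(lam + q) * t) * gamma lam q a j ((1 + a) * (r - t)) := by
  have := intervalIntegral.integral_comp_sub_left (a := 0) (b := r)
    (fun t => gammaFrom lam q a 1 j t * g lam q 1 (r - t)) r
  rw [sub_self, sub_zero] at this
  rw [gamma, gammaFrom, conv_of_nonneg _ _ hr, pow_zero, ← this]
  refine intervalIntegral.integral_congr fun t ht => ?_
  rw [uIcc_of_le hr] at ht
  simp only [gammaFrom_succ ha lam q 0 j (sub_nonneg.2 ht.2), g, gamma, mul_one, sub_sub_cancel]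
  ring_nf

theorem intervalIntegrable_gamma {a : ℝ} (ha : 0 < a) (lam q : ℝ) (j : ℕ) {r : ℝ} (hr : 0 ≤ r) :
    IntervalIntegrable
      (fun t => lam * Real.exp (-(lam + q) * t) * gamma lam q a j ((1 + a) * (r - t)))
      volume 0 r := by
  obtain ⟨G, hG, hEq⟩ := exists_continuous_gammaFrom lam q a 0 j
  refine (Continuous.intervalIntegrable (u := fun t =>
    lam * Real.exp (-(lam + q) * t) * G ((1 + a) * (r - t))) (by fun_prop) 0 r).congr
    fun t ht => ?_
  rw [uIoc_of_le hr] at ht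
  simp only [gamma]
  rw [hEq (mem_Ici.2 (mul_nonneg (by positivity) (sub_nonneg.2 ht.2)))]

/-! ### The renewal equation -/

theorem level_pos {a b : ℝ} (ha : 0 < a) (hb : 0 < b) (n : ℕ) : 0 < level a b n := by
  unfold level; positivity

theorem level_eq_mul_succ {a : ℝ} (ha : 0 < a) (b : ℝ) (n : ℕ) :
    level a b n = (1 + a) * level a b (n + 1) := by
  have : a + 1 ≠ 0 := by positivity
  unfold level
  field_simp
  ring

theorem level_zero (a b : ℝ) : level a b 0 = b := by simp [level]

theorem level_strictAnti {a b : ℝ} (ha : 0 < a) (hb : 0 < b) : StrictAnti (level a b) :=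
  strictAnti_nat_of_succ_lt fun n => by
    rw [level_eq_mul_succ ha b n]
    nlinarith [level_pos ha hb (n + 1)]

/-- The part of the integral beyond `x - y`, shifted back by `x - y`, combines with the exponential
term to `e^(-(lam+q)(x-y))` times the renewal equation at `y`. -/
theorem renewal_split {lam q a b L : ℝ} {F : ℝ → ℝ} (hF : Measurable F) (hF1 : ∀ x, |F x| ≤ 1)
    (hren : ∀ x ∈ Icc L b, F x = Real.exp (-(lam + q) * (x - L)) +
      ∫ t in 0..(x - L), lam * Real.exp (-(lam + q) * t) * F ((1 + a) * (x - t)))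
    {x y : ℝ} (hy : L ≤ y) (hyx : y ≤ x) (hx : x ≤ b) :
    F x = Real.exp (-(lam + q) * (x - y)) * F y +
      ∫ t in 0..(x - y), lam * Real.exp (-(lam + q) * t) * F ((1 + a) * (x - t)) := by
  have hio : ∀ u v, IntegrableOn
      (fun t => lam * Real.exp (-(lam + q) * t) * F ((1 + a) * (x - t))) (Ioc u v) := fun u v =>
    Integrable.mul_bdd (c := 1)
      ((Continuous.integrableOn_Icc (by fun_prop)).mono_set Ioc_subset_Icc_self)
      (Measurable.aestronglyMeasurable (by fun_prop)) (ae_of_all _ fun t => hF1 _)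
  have hii : ∀ u v, IntervalIntegrable
      (fun t => lam * Real.exp (-(lam + q) * t) * F ((1 + a) * (x - t))) volume u v := fun u v =>
    ⟨hio u v, hio v u⟩
  have hsh := intervalIntegral.integral_comp_add_right (a := 0) (b := y - L)
    (fun t => lam * Real.exp (-(lam + q) * t) * F ((1 + a) * (x - t))) (x - y)
  have hconst := intervalIntegral.integral_const_mul (μ := volume) (a := 0) (b := y - L)
    (Real.exp (-(lam + q) * (x - y)))
    (fun t => lam * Real.exp (-(lam + q) * t) * F ((1 + a) * (y - t)))
  have hcongr : ∀ t, lam * Real.exp (-(lam + q) * (t + (x - y))) * F ((1 + a) * (x - (t + (x - y)))) =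
      Real.exp (-(lam + q) * (x - y)) * (lam * Real.exp (-(lam + q) * t) * F ((1 + a) * (y - t))) := by
    intro t
    rw [mul_add, Real.exp_add, show x - (t + (x - y)) = y - t by ring]
    ring
  simp only [hcongr, hconst, zero_add, show y - L + (x - y) = x - L by ring] at hsh
  rw [hren x ⟨hy.trans hyx, hx⟩, hren y ⟨hy, hyx.trans hx⟩,
    ← intervalIntegral.integral_add_adjacent_intervals (hii 0 (x - y)) (hii _ _), mul_add, hsh, ← Real.exp_add,
    show -(lam + q) * (x - y) + -(lam + q) * (y - L) = -(lam + q) * (x - L) by ring]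
  ring

theorem renewal_solution {lam q a b : ℝ} (ha : 0 < a) (hb : 0 < b) {N : ℕ} {F : ℝ → ℝ}
    (hF : Measurable F) (hF1 : ∀ x, |F x| ≤ 1) (hF0 : ∀ x, b < x → F x = 0)
    (hren : ∀ x ∈ Icc (level a b N) b, F x = Real.exp (-(lam + q) * (x - level a b N)) +
      ∫ t in 0..(x - level a b N), lam * Real.exp (-(lam + q) * t) * F ((1 + a) * (x - t)))
    {n : ℕ} (hn : n + 1 ≤ N) {x : ℝ} (hx : level a b (n + 1) ≤ x) (hxn : x ≤ level a b n) :
    F x = ∑ j ∈ Finset.range (n + 1), gamma lam q a j (x - level a b (n + 1)) *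
      F (level a b (n + 1 - j)) := by
  have hanti := (level_strictAnti ha hb).antitone
  have hlev : ∀ n, level a b n ≤ b := fun n => by
    simpa only [level_zero] using hanti (Nat.zero_le n)
  have hg0 : ∀ t, gamma lam q a 0 t = Real.exp (-(lam + q) * t) := fun t => by
    simp [gamma, gammaFrom, Gbar]
  induction n generalizing x with
  | zero =>
    rw [renewal_split hF hF1 hren (hanti hn) hx (hxn.trans (hlev _)), Finset.sum_range_one, hg0]
    rw [intervalIntegral.integral_zero_ae, add_zero]
    -- At `t = x - L_1` the restart is exactly at `b`, where `F` need not vanish; for smaller `t` it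
    -- is above `b`.
    have hne : ∀ᵐ t ∂(volume : Measure ℝ), t ≠ x - level a b 1 := by simp [ae_iff]
    filter_upwards [hne] with t ht hmem
    rw [uIoc_of_le (sub_nonneg.2 hx)] at hmem
    have hlt := lt_of_le_of_ne hmem.2 ht
    rw [hF0, mul_zero]
    have h0 := level_eq_mul_succ ha b 0
    rw [level_zero] at h0
    rw [h0]
    exact mul_lt_mul_of_pos_left (by linarith) (by linarith)
  | succ n ih =>
    have hr : 0 ≤ x - level a b (n + 1 + 1) := sub_nonneg.2 hx
    rw [renewal_split hF hF1 hren (hanti hn) hx (hxn.trans (hlev _)), Finset.sum_range_succ', hg0,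
      add_comm]
    congr 1
    -- The restarted surplus lies one interval higher, so the induction hypothesis applies under the
    -- integral.
    have hcongr : ∀ t ∈ uIcc 0 (x - level a b (n + 1 + 1)),
        lam * Real.exp (-(lam + q) * t) * F ((1 + a) * (x - t)) =
        ∑ j ∈ Finset.range (n + 1), lam * Real.exp (-(lam + q) * t) *
          gamma lam q a j ((1 + a) * (x - level a b (n + 1 + 1) - t)) *
            F (level a b (n + 1 - j)) := by
      intro t ht
      rw [uIcc_of_le hr] at ht
      have h1 := level_eq_mul_succ ha b (n + 1)
      have h2 := level_eq_mul_succ ha b n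
      rw [ih (by omega) (x := (1 + a) * (x - t))
        (by rw [h1]; exact mul_le_mul_of_nonneg_left (by linarith [ht.2]) (by linarith))
        (by rw [h2]; exact mul_le_mul_of_nonneg_left (by linarith [ht.1]) (by linarith)),
        Finset.mul_sum]
      refine Finset.sum_congr rfl fun j _ => ?_
      rw [show (1 + a) * (x - level a b (n + 1 + 1) - t) = (1 + a) * (x - t) - level a b (n + 1) by
        rw [h1]; ring]
      ring
    rw [intervalIntegral.integral_congr hcongr, intervalIntegral.integral_finsetSum fun j _ =>
      (intervalIntegrable_gamma ha lam q j hr).mul_const _]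
    refine Finset.sum_congr rfl fun j _ => ?_
    rw [intervalIntegral.integral_mul_const, ← gamma_succ ha lam q j hr, Nat.add_sub_add_right]

end DualRisk

/-! ### Transfer to the given probability space and the linear system -/

open DualRisk in
theorem mainTheorem3 {Ω : Type*} [MeasurableSpace Ω] (P : Measure Ω) [IsProbabilityMeasure P]
    (lam a b q : ℝ) (hlam : 0 < lam) (ha : 0 < a) (hb : 0 < b) (hq : 0 ≤ q)
    (τ : ℕ → Ω → ℝ) (hlaw : ∀ i, HasLaw (τ i) (expMeasure lam) P) (hindep : iIndepFun τ P)
    (N : ℕ) (hN : 1 ≤ N) :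
    (∀ n : ℕ, 1 ≤ n → n ≤ N → ∀ x : ℝ,
      DualRisk.level a b n < x → x ≤ DualRisk.level a b (n - 1) →
        Integrable (DualRisk.discountedExit a b q τ N x) P ∧
        DualRisk.exitTransform P a b q τ N x =
          ∑ j ∈ Finset.range n, DualRisk.gamma lam q a j (x - DualRisk.level a b n) *
            DualRisk.exitValue P a b q τ N (n - j)) ∧
    DualRisk.exitValue P a b q τ N N = 1 ∧
    DualRisk.rhoVector P a b q τ N =
      (DualRisk.GammaMatrix lam q a b N).mulVec (DualRisk.rhoVector P a b q τ N) +
        DualRisk.ZVector lam q a b N := by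
  have hanti := level_strictAnti ha hb
  have hlev : ∀ n, level a b n ≤ b := fun n => by
    simpa only [level_zero] using hanti.antitone (Nat.zero_le n)
  have hτ : AEMeasurable (fun ω i => τ i ω) P := aemeasurable_pi_iff.2 fun i => (hlaw i).aemeasurable
  have hmap : P.map (fun ω i => τ i ω) = arrivalLaw lam :=
    (hindep.hasLaw_infinitePi hlaw hτ).map_eq
  have hpath : ∀ x, level a b N ≤ x →
      Integrable (pathExit a b q N x) (P.map fun ω i => τ i ω) := fun x hx => by
    rw [hmap]; exact integrable_pathExit hlam ha hb hq hx
  obtain ⟨F, hF, hF1, hFE⟩ := exists_measurable_pathMean hlam ha hb hq N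
  have hE : ∀ x, level a b N ≤ x → exitTransform P a b q τ N x = F x := by
    intro x hx
    rw [← hFE x hx, ← hmap, integral_map hτ (hpath x hx).aestronglyMeasurable]
    rfl
  have hren : ∀ x ∈ Icc (level a b N) b, F x = Real.exp (-(lam + q) * (x - level a b N)) +
      ∫ t in 0..(x - level a b N), lam * Real.exp (-(lam + q) * t) * F ((1 + a) * (x - t)) := by
    intro x hx
    rw [← hFE x hx.1, pathMean_eq hlam ha hb hq hx]
    congr 1
    refine intervalIntegral.integral_congr fun t ht => ?_
    rw [uIcc_of_le (sub_nonneg.2 hx.1)] at ht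
    simp only [hFE ((1 + a) * (x - t)) (by nlinarith [ht.2, level_pos ha hb N])]
  have hF0 : ∀ x, b < x → F x = 0 := fun x hx => by
    rw [← hFE x ((hlev N).trans hx.le), pathMean_of_gt hlam hx]
  have hsol : ∀ n, n + 1 ≤ N → ∀ x, level a b (n + 1) ≤ x → x ≤ level a b n →
      exitTransform P a b q τ N x = ∑ j ∈ Finset.range (n + 1),
        gamma lam q a j (x - level a b (n + 1)) * exitValue P a b q τ N (n + 1 - j) := by
    intro n hn x hx hxn
    rw [hE x ((hanti.antitone hn).trans hx),
      renewal_solution ha hb hF hF1 hF0 hren hn hx hxn]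
    refine Finset.sum_congr rfl fun j _ => ?_
    rw [exitValue, hE _ (hanti.antitone (by omega))]
  have hone : exitValue P a b q τ N N = 1 := by
    rw [exitValue, hE _ le_rfl, hren _ ⟨le_rfl, hlev N⟩]
    simp
  refine ⟨fun n hn hnN x hx hxn => ?_, hone, ?_⟩
  · obtain ⟨n, rfl⟩ : ∃ m, n = m + 1 := ⟨n - 1, by omega⟩
    exact ⟨(hpath x ((hanti.antitone hnN).trans hx.le)).comp_aemeasurable hτ,
      hsol n hnN x hx.le hxn⟩
  · ext i
    obtain ⟨i, hi⟩ := i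
    have hrow := hsol (i + 1) (by omega) (level a b (i + 1)) (hanti.antitone (by omega)) le_rfl
    have hcoef : ∀ j, gamma lam q a j (level a b (i + 1) - level a b (i + 1 + 1)) =
        gammaCoeff lam q a b j (i + 1) := by
      intro j
      have : a + 1 ≠ 0 := by positivity
      rw [gammaCoeff]
      congr 1
      unfold level
      field_simp
      ring
    simp only [hcoef] at hrow
    -- Reversing the sum indexes it by the column `k = j + 1` instead of by the order of `γ`.
    rw [← Finset.sum_range_reflect] at hrow
    have hrow' : exitTransform P a b q τ N (level a b (i + 1)) = ∑ j ∈ Finset.range (i + 1 + 1),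
        gammaCoeff lam q a b (i + 1 - j) (i + 1) * exitValue P a b q τ N (j + 1) := by
      rw [hrow]
      refine Finset.sum_congr rfl fun j hj => ?_
      have := Finset.mem_range.1 hj
      congr 2
      omega
    have hsum : ((GammaMatrix lam q a b N).mulVec (rhoVector P a b q τ N)) ⟨i, hi⟩ =
        ∑ j ∈ Finset.range (N - 1), (if j ≤ i + 1 then gammaCoeff lam q a b (i + 1 - j) (i + 1)
          else 0) * exitValue P a b q τ N (j + 1) := by
      rw [← Fin.sum_univ_eq_sum_range (fun j => (if j ≤ i + 1 then
        gammaCoeff lam q a b (i + 1 - j) (i + 1) else 0) * exitValue P a b q τ N (j + 1))]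
      simp [Matrix.mulVec, dotProduct, GammaMatrix, rhoVector]
    -- Columns beyond `n + 1`, where `n = i + 1`, contribute zero, so the row sum may be extended to
    -- any length `m ≥ n + 1`.
    have hrest : ∀ m, i + 1 + 1 ≤ m → ∑ j ∈ Finset.range m,
        (if j ≤ i + 1 then gammaCoeff lam q a b (i + 1 - j) (i + 1) else 0) *
          exitValue P a b q τ N (j + 1) = ∑ j ∈ Finset.range (i + 1 + 1),
        gammaCoeff lam q a b (i + 1 - j) (i + 1) * exitValue P a b q τ N (j + 1) := by
      intro m hm
      rw [← Finset.sum_subset (Finset.range_subset_range.2 hm)]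
      · refine Finset.sum_congr rfl fun j hj => ?_
        rw [if_pos (Nat.lt_succ_iff.1 (Finset.mem_range.1 hj))]
      · intro j _ hj
        rw [if_neg (by simp only [Finset.mem_range] at hj; omega), zero_mul]
    rw [Pi.add_apply, hsum]
    change exitTransform P a b q τ N (level a b (i + 1)) = _ + ite (i + 1 = N - 1) _ _
    rw [hrow']
    split_ifs with hlast
    -- In the last row the sum has one term more than the matrix has columns. This term, `γ_(0,N-1)
    -- * ρ_N` with `ρ_N = 1`, is the entry of `Z`.
    · rw [← hrest (N - 1 + 1) (by omega), Finset.sum_range_succ, Nat.sub_add_cancel hN, hone,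
        if_pos hlast.ge, hlast, Nat.sub_self, mul_one]
    · rw [add_zero, hrest (N - 1) (by omega)]
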